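/- Notation. For $\theta\in\mathbb R$ let $b_1=(\cos\theta,\sin\theta)$, $b_2=(-\sin\theta,\cos\theta)$ and $\xi=(b_1+b_2)/\|b_1+b_2\|$, let $R$ be the counterclockwise rotation by $\pi/2$ in the plane, and for a unit vector $v$ and $y\in\mathbb R^2$ let $C_v(y)$ be the infinite open cone with vertex $y$, axis direction $v$ and opening angle $\pi/2$. A set $S\subset\mathbb R^2$ is $\theta$-biconvex if its intersection with every line parallel to $b_1$ or to $b_2$ is convex. The $\theta$-biconvex hull of $A\subset\mathbb R^2$ is $$\mathbb B_\theta(A)=\bigcap\big\{\mathbb R^2\setminus C_{R^i\xi}(y):\ i\in\{0,1,2,3\},\ y\in\mathbb R^2,\ C_{R^i\xi}(y)\cap A=\emptyset\big\}.$$ Let $\mu_L$ be the Lebesgue measure on $\mathbb R^2$. A set $E\subset\mathbb R^2$ has finite Minkowski content $L\in[0,\infty)$ if $\lim_{\varepsilon\to0^+}\mu_L\big(\bigcup_{s\in E}B(s,\varepsilon)\big)/(2\varepsilon)=L$, where $B(s,\varepsilon)$ is the closed ball. Theorem. Let $S\subset\mathbb R^2$ be compact and path connected, and suppose that the set $A$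 of angles $\theta\in[0,\pi/2)$ for which $S$ is $\theta$-biconvex is not empty. Assume that there is a constant $L_0$ such that for every $\theta\in[0,\pi/2)$ the boundary $\partial\mathbb B_\theta(S)$ has a finite Minkowski content $L_0(\theta)\le L_0$. Let $X_1,X_2,\dots$ be independent, identically distributed random points of $\mathbb R^2$ whose common distribution has support $S$, and let $\mathcal X_n=\{X_1,\dots,X_n\}$ and $\Psi_n(\theta)=\mu_L(\mathbb B_\theta(\mathcal X_n))$. For each $n$ let $\hat\theta_n$ be a random angle that almost surely minimizes $\Psi_n$ over $[0,\pi/2]$. Then, with probability one, all the accumulation points of the sequence $(\hat\theta_n)$ (the limits of its convergent subsequences) belong to $A$, where the angle $\pi/2$ is identified with the angle $0$; that is, every accumulation point is an element of $A$, or it equals $\pi/2$ and $0\in A$. -/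

import Mathlib

open MeasureTheory ProbabilityTheory Filter Topology
open scoped NNReal ENNReal

noncomputable section

namespace Biconvex

/-- The Euclidean plane. -/
abbrev Plane : Type := EuclideanSpace ℝ (Fin 2)

/-- The first axis `b₁`: the vector `(1, 0)` rotated counterclockwise by the angle `θ`. -/
def axis₁ (θ : ℝ) : Plane := !₂[Real.cos θ, Real.sin θ]

/-- The second axis `b₂`: the vector `(0, 1)` rotated counterclockwise by the angle `θ`. -/
def axis₂ (θ : ℝ) : Plane := !₂[-Real.sin θ, Real.cos θ]

/-- The set `S` is `θ`-biconvex: its sections by all lines parallel to `b₁` or to `b₂`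
are convex. -/
def IsBiconvexAt (θ : ℝ) (S : Set Plane) : Prop :=
  (∀ α : ℝ, Convex ℝ ({x | ∃ t : ℝ, x = α • axis₁ θ + t • axis₂ θ} ∩ S)) ∧
  (∀ β : ℝ, Convex ℝ ({x | ∃ t : ℝ, x = t • axis₁ θ + β • axis₂ θ} ∩ S))

/-- The set of biconvexity angles of `S`. -/
def biconvexityAngles (S : Set Plane) : Set ℝ :=
  {θ | θ ∈ Set.Ico 0 (Real.pi / 2) ∧ IsBiconvexAt θ S}

/-- Counterclockwise rotation by `π / 2`. -/
def rot (v : Plane) : Plane := !₂[-v 1, v 0]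

/-- The infinite open cone with vertex `y`, opening angle `π / 2` and axis the unit vector `v`:
the points `x ≠ y` such that the angle between `x - y` and `v` is less than `π / 4`. -/
def cone (v y : Plane) : Set Plane :=
  {x | ‖x - y‖ * Real.cos (Real.pi / 4) < inner ℝ (x - y) v}

/-- The direction `ξ = (b₁ + b₂) / ‖b₁ + b₂‖`. -/
def diagonal (θ : ℝ) : Plane := ‖axis₁ θ + axis₂ θ‖⁻¹ • (axis₁ θ + axis₂ θ)

/-- The (lighthouse) `θ`-biconvex hull of `A`: the intersection of the complements of all the open
cones with opening angle `π / 2` and axis `ξ`, `R ξ`, `R² ξ` or `R³ ξ` that do not meet `A`. -/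
def hull (θ : ℝ) (A : Set Plane) : Set Plane :=
  ⋂ (i : Fin 4) (y : Plane) (_ : cone (rot^[i] (diagonal θ)) y ∩ A = ∅),
    (cone (rot^[i] (diagonal θ)) y)ᶜ

/-- The Minkowski content of `E` (in the plane, for one-dimensional sets such as boundaries) exists,
is finite and equals `L`: the area of the closed parallel set of radius `ε` around `E`, divided by
`2 ε`, tends to `L` as `ε` decreases to `0`. -/
def HasMinkowskiContent (E : Set Plane) (L : ℝ≥0) : Prop :=
  Tendsto (fun ε : ℝ => volume (⋃ s ∈ E, Metric.closedBall s ε) / ENNReal.ofReal (2 * ε))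
    (𝓝[>] 0) (𝓝 (L : ℝ≥0∞))

/-- The sample of size `n`, as a subset of the plane. -/
def sample {Ω : Type*} (X : ℕ → Ω → Plane) (n : ℕ) (ω : Ω) : Set Plane :=
  {x | ∃ i < n, x = X i ω}

/-- The area of the `θ`-biconvex hull of the sample of size `n`. -/
def hullArea {Ω : Type*} (X : ℕ → Ω → Plane) (n : ℕ) (ω : Ω) (θ : ℝ) : ℝ≥0∞ :=
  volume (hull θ (sample X n ω))

/-- The angles in `[0, π / 2]` that minimize the area of the hull of the sample of size `n`. -/
def argminAngles {Ω : Type*} (X : ℕ → Ω → Plane) (n : ℕ) (ω : Ω) : Set ℝ :=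
  {θ | θ ∈ Set.Icc 0 (Real.pi / 2) ∧
    ∀ θ' ∈ Set.Icc 0 (Real.pi / 2), hullArea X n ω θ ≤ hullArea X n ω θ'}

end Biconvex

end

noncomputable section

namespace Biconvex

/-! ### Rotated coordinates -/

/-! The set fills its hull exactly at its biconvexity angles, up to null sets, and area detects
this. At an angle `θ₀` in `A`, compactness and connectedness give `hull θ₀ S ⊆ S`
(`hull_subset_of_isBiconvexAt`), so every sample hull at `θ₀` lies in `S` and the minimal area is at
most the area of `S`.

Let minimizers converge to `θ` along a subsequence. A point whose four open quadrants at angle `θ`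
all meet `S` keeps this property for nearby angles and for the sample, which is eventually dense in
`S`. Hence it eventually lies in the sample hulls (`eventually_mem_hull`), and the set of such
points has area at most that of `S`. The rest of `hull θ S` lies in its frontier, which is null by
the Minkowski content hypothesis. So `hull θ S \ S` is null, and a separation argument
(`sectionsConvex_of_volume_hull_diff`) shows that a closed connected set with this property has no
gaps in its sections. -/

/-- The coordinate of `x` along `axis₁ θ`. -/
def coord₁ (θ : ℝ) (x : Plane) : ℝ := x 0 * Real.cos θ + x 1 * Real.sin θ

/-- The coordinate of `x` along `axis₂ θ`. -/
def coord₂ (θ : ℝ) (x : Plane) : ℝ := -(x 0 * Real.sin θ) + x 1 * Real.cos θ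

/-- The point with coordinates `a`, `b` along the axes of angle `θ`. -/
def ofCoords (θ a b : ℝ) : Plane := a • axis₁ θ + b • axis₂ θ

@[fun_prop]
lemma continuous_coord₁ (θ : ℝ) : Continuous (coord₁ θ) := by
  unfold coord₁; fun_prop

@[fun_prop]
lemma continuous_coord₂ (θ : ℝ) : Continuous (coord₂ θ) := by
  unfold coord₂; fun_prop

@[simp]
lemma coord₁_ofCoords (θ a b : ℝ) : coord₁ θ (ofCoords θ a b) = a := by
  simp [coord₁, ofCoords, axis₁, axis₂]
  linear_combination a * Real.sin_sq_add_cos_sq θ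

@[simp]
lemma coord₂_ofCoords (θ a b : ℝ) : coord₂ θ (ofCoords θ a b) = b := by
  simp [coord₂, ofCoords, axis₁, axis₂]
  linear_combination b * Real.sin_sq_add_cos_sq θ

lemma ofCoords_coord (θ : ℝ) (x : Plane) : ofCoords θ (coord₁ θ x) (coord₂ θ x) = x := by
  ext i
  fin_cases i
  · simp [coord₁, coord₂, ofCoords, axis₁, axis₂]
    linear_combination x 0 * Real.sin_sq_add_cos_sq θ
  · simp [coord₁, coord₂, ofCoords, axis₁, axis₂]
    linear_combination x 1 * Real.sin_sq_add_cos_sq θ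

lemma eq_of_coord_eq {θ : ℝ} {x y : Plane} (h₁ : coord₁ θ x = coord₁ θ y)
    (h₂ : coord₂ θ x = coord₂ θ y) : x = y := by
  rw [← ofCoords_coord θ x, h₁, h₂, ofCoords_coord]

lemma norm_sub_sq_eq (θ : ℝ) (x y : Plane) :
    ‖x - y‖ ^ 2 = (coord₁ θ x - coord₁ θ y) ^ 2 + (coord₂ θ x - coord₂ θ y) ^ 2 := by
  rw [EuclideanSpace.norm_sq_eq]
  simp [coord₁, coord₂]
  linear_combination (-(x 0 - y 0) ^ 2 - (x 1 - y 1) ^ 2) * Real.sin_sq_add_cos_sq θ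

lemma coord₁_add_pi_div_two (θ : ℝ) (x : Plane) : coord₁ (θ + Real.pi / 2) x = coord₂ θ x := by
  simp [coord₁, coord₂, Real.cos_add_pi_div_two, Real.sin_add_pi_div_two]

lemma coord₂_add_pi_div_two (θ : ℝ) (x : Plane) : coord₂ (θ + Real.pi / 2) x = -coord₁ θ x := by
  simp [coord₁, coord₂, Real.cos_add_pi_div_two, Real.sin_add_pi_div_two]
  ring

/-- A closed set misses an open box around each point outside it. -/
lemma exists_box_disjoint {S : Set Plane} (hS : IsClosed S) (θ : ℝ) {p : Plane} (hp : p ∉ S) :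
    ∃ δ > 0, ∀ x, |coord₁ θ x - coord₁ θ p| < δ → |coord₂ θ x - coord₂ θ p| < δ → x ∉ S := by
  obtain ⟨ε, hε, hball⟩ := Metric.isOpen_iff.1 hS.isOpen_compl p hp
  refine ⟨ε / 2, by positivity, fun x h₁ h₂ => hball ?_⟩
  rw [Metric.mem_ball, dist_eq_norm]
  have h := norm_sub_sq_eq θ x p
  rw [← sq_abs (coord₁ θ x - _), ← sq_abs (coord₂ θ x - _)] at h
  nlinarith [abs_nonneg (coord₁ θ x - coord₁ θ p), abs_nonneg (coord₂ θ x - coord₂ θ p),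
    norm_nonneg (x - p)]

/-! ### Quadrants -/

/-- The real number `s` is `1` or `-1`. -/
def IsSign (s : ℝ) : Prop := s = 1 ∨ s = -1

/-- The open quadrant with vertex `y` whose sides have directions `s • axis₁ θ`, `t • axis₂ θ`. -/
def quadrant (θ s t : ℝ) (y : Plane) : Set Plane :=
  {x | 0 < s * (coord₁ θ x - coord₁ θ y) ∧ 0 < t * (coord₂ θ x - coord₂ θ y)}

lemma quadrant_subset {θ s t : ℝ} {x y : Plane} (h : x ∈ quadrant θ s t y) :
    quadrant θ s t x ⊆ quadrant θ s t y := fun z hz =>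
  ⟨by nlinarith [hz.1, h.1], by nlinarith [hz.2, h.2]⟩

lemma quadrant_add_pi_div_two (θ s t : ℝ) (y : Plane) :
    quadrant (θ + Real.pi / 2) s t y = quadrant θ (-t) s y := by
  ext x
  simp only [quadrant, Set.mem_ofPred_eq, coord₁_add_pi_div_two, coord₂_add_pi_div_two]
  rw [and_comm]
  ring_nf

lemma norm_axis₁_add_axis₂ (θ : ℝ) : ‖axis₁ θ + axis₂ θ‖ = √2 := by
  rw [EuclideanSpace.norm_eq]
  congr 1
  simp [axis₁, axis₂]
  linear_combination 2 * Real.sin_sq_add_cos_sq θ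

lemma lt_add_iff_of_sq_eq {r p q : ℝ} (hr : 0 ≤ r) (h : r ^ 2 = p ^ 2 + q ^ 2) :
    r < p + q ↔ 0 < p ∧ 0 < q := by
  constructor
  · intro hlt
    have hpq : 0 < p * q := by nlinarith
    rcases pos_and_pos_or_neg_and_neg_of_mul_pos hpq with h' | h'
    · exact h'
    · linarith [h'.1, h'.2]
  · rintro ⟨hp, hq⟩
    nlinarith [mul_pos hp hq]

/-- After cancelling `√2 / 2`, the angle condition reads `r < p + q` with `r ^ 2 = p ^ 2 + q ^ 2`,
which holds exactly when both signed coordinates `p`, `q` are positive. -/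
lemma cone_eq_quadrant {θ s t : ℝ} (hs : IsSign s) (ht : IsSign t) {v : Plane}
    (hv : ∀ d : Plane, inner ℝ d v = √2 / 2 * (s * coord₁ θ d + t * coord₂ θ d)) (y : Plane) :
    cone v y = quadrant θ s t y := by
  ext x
  have hs' : s ^ 2 = 1 := by rcases hs with rfl | rfl <;> norm_num
  have ht' : t ^ 2 = 1 := by rcases ht with rfl | rfl <;> norm_num
  have h₁ : coord₁ θ (x - y) = coord₁ θ x - coord₁ θ y := by simp [coord₁]; ring
  have h₂ : coord₂ θ (x - y) = coord₂ θ x - coord₂ θ y := by simp [coord₂]; ring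
  have h2 : 0 < √2 / 2 := by positivity
  simp only [cone, quadrant, Set.mem_ofPred_eq, hv, h₁, h₂, Real.cos_pi_div_four]
  rw [mul_comm, mul_lt_mul_iff_right₀ h2]
  apply lt_add_iff_of_sq_eq (norm_nonneg _)
  rw [norm_sub_sq_eq θ, mul_pow, mul_pow, hs', ht', one_mul, one_mul]

lemma diagonal_eq (θ : ℝ) : diagonal θ = (√2 / 2) • (axis₁ θ + axis₂ θ) := by
  rw [diagonal, norm_axis₁_add_axis₂, Real.sqrt_div_self]

lemma inner_eq_sum (x y : Plane) : inner ℝ x y = x 0 * y 0 + x 1 * y 1 := by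
  simp [PiLp.inner_apply, mul_comm]

lemma cone_diagonal_zero (θ : ℝ) (y : Plane) :
    cone (rot^[0] (diagonal θ)) y = quadrant θ 1 1 y := by
  refine cone_eq_quadrant (.inl rfl) (.inl rfl) (fun d => ?_) y
  simp [diagonal_eq, inner_eq_sum, axis₁, axis₂, coord₁, coord₂]
  ring

lemma cone_diagonal_one (θ : ℝ) (y : Plane) :
    cone (rot^[1] (diagonal θ)) y = quadrant θ (-1) 1 y := by
  refine cone_eq_quadrant (.inr rfl) (.inl rfl) (fun d => ?_) y
  simp [diagonal_eq, inner_eq_sum, axis₁, axis₂, coord₁, coord₂, rot]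
  ring

lemma cone_diagonal_two (θ : ℝ) (y : Plane) :
    cone (rot^[2] (diagonal θ)) y = quadrant θ (-1) (-1) y := by
  refine cone_eq_quadrant (.inr rfl) (.inr rfl) (fun d => ?_) y
  simp [diagonal_eq, inner_eq_sum, axis₁, axis₂, coord₁, coord₂, rot]
  ring

lemma cone_diagonal_three (θ : ℝ) (y : Plane) :
    cone (rot^[3] (diagonal θ)) y = quadrant θ 1 (-1) y := by
  refine cone_eq_quadrant (.inl rfl) (.inr rfl) (fun d => ?_) y
  simp [diagonal_eq, inner_eq_sum, axis₁, axis₂, coord₁, coord₂, rot]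
  ring

lemma mem_hull_iff {θ : ℝ} {A : Set Plane} {x : Plane} :
    x ∈ hull θ A ↔ ∀ s t : ℝ, IsSign s → IsSign t → ∀ y, x ∈ quadrant θ s t y →
      (quadrant θ s t y ∩ A).Nonempty := by
  simp only [hull, Set.mem_iInter, Set.mem_compl_iff, Fin.forall_fin_succ, Fin.val_zero,
    Fin.val_succ, IsEmpty.forall_iff, cone_diagonal_zero, cone_diagonal_one, cone_diagonal_two,
    cone_diagonal_three, zero_add, Nat.reduceAdd, and_true, ← Set.not_nonempty_iff_eq_empty,
    not_imp_not]
  refine ⟨fun ⟨h₀, h₁, h₂, h₃⟩ => ?_, fun h => ⟨?_, ?_, ?_, ?_⟩⟩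
  · rintro s t (rfl | rfl) (rfl | rfl) <;> assumption
  · exact h 1 1 (.inl rfl) (.inl rfl)
  · exact h (-1) 1 (.inr rfl) (.inl rfl)
  · exact h (-1) (-1) (.inr rfl) (.inr rfl)
  · exact h 1 (-1) (.inl rfl) (.inr rfl)

lemma IsSign.neg {s : ℝ} (hs : IsSign s) : IsSign (-s) := by
  rcases hs with rfl | rfl
  · exact .inr rfl
  · exact .inl (neg_neg 1)

/-- A quarter turn permutes the four sign pairs. This transfers arguments about one axis to the
other and identifies the angles `0` and `π / 2`. -/
lemma hull_add_pi_div_two (θ : ℝ) (A : Set Plane) : hull (θ + Real.pi / 2) A = hull θ A := by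
  ext x
  simp only [mem_hull_iff, quadrant_add_pi_div_two]
  refine ⟨fun h s t hs ht => ?_, fun h s t hs ht => h (-t) s ht.neg hs⟩
  have := h t (-s) ht hs.neg
  rwa [neg_neg] at this

lemma subset_hull (θ : ℝ) (A : Set Plane) : A ⊆ hull θ A := fun x hx =>
  mem_hull_iff.2 fun _ _ _ _ _ hxy => ⟨x, hxy, hx⟩

lemma hull_mono (θ : ℝ) {A B : Set Plane} (h : A ⊆ B) : hull θ A ⊆ hull θ B := fun _ hx =>
  mem_hull_iff.2 fun s t hs ht y hy =>
    (mem_hull_iff.1 hx s t hs ht y hy).mono (Set.inter_subset_inter_right _ h)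

lemma disjoint_quadrant_hull {θ s t : ℝ} (hs : IsSign s) (ht : IsSign t) {y : Plane}
    {A : Set Plane} (h : ¬ (quadrant θ s t y ∩ A).Nonempty) :
    quadrant θ s t y ⊆ (hull θ A)ᶜ := fun _ hx hx' =>
  h (mem_hull_iff.1 hx' s t hs ht y hx)

/-- A point outside the hull is the vertex of an open quadrant that misses the set. -/
lemma exists_quadrant_of_notMem_hull {θ : ℝ} {A : Set Plane} {x : Plane} (h : x ∉ hull θ A) :
    ∃ s t : ℝ, IsSign s ∧ IsSign t ∧ ¬ (quadrant θ s t x ∩ A).Nonempty := by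
  rw [mem_hull_iff] at h
  push Not at h
  obtain ⟨s, t, hs, ht, y, hxy, hy⟩ := h
  refine ⟨s, t, hs, ht, fun hne => ?_⟩
  have := hne.mono (Set.inter_subset_inter_left A (quadrant_subset hxy))
  rw [hy] at this
  exact Set.not_nonempty_empty this

/-! ### Biconvexity in rotated coordinates -/

/-- The section of `S` by every line parallel to `axis₁ θ` has no gap. -/
def SectionsConvex (θ : ℝ) (S : Set Plane) : Prop :=
  ∀ a ∈ S, ∀ b ∈ S, ∀ p, coord₂ θ a = coord₂ θ p → coord₂ θ b = coord₂ θ p →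
    coord₁ θ a < coord₁ θ p → coord₁ θ p < coord₁ θ b → p ∈ S

lemma coord₁_combo (θ c d : ℝ) (x y : Plane) :
    coord₁ θ (c • x + d • y) = c * coord₁ θ x + d * coord₁ θ y := by
  simp [coord₁]; ring

lemma coord₂_combo (θ c d : ℝ) (x y : Plane) :
    coord₂ θ (c • x + d • y) = c * coord₂ θ x + d * coord₂ θ y := by
  simp [coord₂]; ring

lemma line₁_eq (θ β : ℝ) :
    {x | ∃ t : ℝ, x = t • axis₁ θ + β • axis₂ θ} = {x | coord₂ θ x = β} := by
  ext x
  constructor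
  · rintro ⟨t, rfl⟩
    exact coord₂_ofCoords θ t β
  · rintro rfl
    exact ⟨coord₁ θ x, (ofCoords_coord θ x).symm⟩

lemma line₂_eq (θ α : ℝ) :
    {x | ∃ t : ℝ, x = α • axis₁ θ + t • axis₂ θ} = {x | coord₁ θ x = α} := by
  ext x
  constructor
  · rintro ⟨t, rfl⟩
    exact coord₁_ofCoords θ α t
  · rintro rfl
    exact ⟨coord₂ θ x, (ofCoords_coord θ x).symm⟩

lemma forall_convex_line_iff (θ : ℝ) (S : Set Plane) :
    (∀ β : ℝ, Convex ℝ ({x | coord₂ θ x = β} ∩ S)) ↔ SectionsConvex θ S := by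
  constructor
  · intro h a ha b hb p hap hbp h₁ h₂
    have hpos : 0 < coord₁ θ b - coord₁ θ a := by linarith
    have hmem := h (coord₂ θ p) (x := a) ⟨hap, ha⟩ (y := b) ⟨hbp, hb⟩
      (a := (coord₁ θ b - coord₁ θ p) / (coord₁ θ b - coord₁ θ a))
      (b := (coord₁ θ p - coord₁ θ a) / (coord₁ θ b - coord₁ θ a))
      (div_nonneg (by linarith) hpos.le) (div_nonneg (by linarith) hpos.le)
      (by field_simp; ring)
    convert hmem.2 using 1
    apply eq_of_coord_eq (θ := θ)
    · rw [coord₁_combo]; field_simp; ring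
    · exact hmem.1.symm
  · intro h β
    have key : ∀ x ∈ {x | coord₂ θ x = β} ∩ S, ∀ y ∈ {x | coord₂ θ x = β} ∩ S, ∀ c d : ℝ,
        0 ≤ c → 0 ≤ d → c + d = 1 → coord₁ θ x ≤ coord₁ θ y → c • x + d • y ∈ S := by
      rintro x ⟨hx, hxS⟩ y ⟨hy, hyS⟩ c d hc hd hcd hle
      have e₁ := coord₁_combo θ c d x y
      have e₂ := coord₂_combo θ c d x y
      have hx' : coord₂ θ x = β := hx
      have hy' : coord₂ θ y = β := hy
      obtain rfl : c = 1 - d := by linarith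
      have e₂' : coord₂ θ ((1 - d) • x + d • y) = β := by rw [e₂, hx', hy']; ring
      rcases hd.eq_or_lt with rfl | hd
      · simpa using hxS
      rcases hc.eq_or_lt with hc | hc
      · obtain rfl : d = 1 := by linarith
        simpa using hyS
      rcases hle.eq_or_lt with heq | hlt
      · have : x = y := eq_of_coord_eq heq (hx'.trans hy'.symm)
        subst this
        rwa [← add_smul, hcd, one_smul]
      · refine h x hxS y hyS _ (hx'.trans e₂'.symm) (hy'.trans e₂'.symm) ?_ ?_ <;> rw [e₁]
        · nlinarith
        · nlinarith
    intro x hx y hy c d hc hd hcd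
    refine ⟨?_, ?_⟩
    · change coord₂ θ (c • x + d • y) = β
      have hx' : coord₂ θ x = β := hx.1
      have hy' : coord₂ θ y = β := hy.1
      rw [coord₂_combo, hx', hy', ← add_mul, hcd, one_mul]
    · rcases le_total (coord₁ θ x) (coord₁ θ y) with hle | hle
      · exact key x hx y hy c d hc hd hcd hle
      · rw [add_comm]
        exact key y hy x hx d c hd hc (by linarith) hle

/-- Lines parallel to `axis₂ θ` are lines parallel to the first axis at `θ + π / 2`, with the offset
changing sign; so a single direction need be studied. -/
lemma isBiconvexAt_iff {θ : ℝ} {S : Set Plane} :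
    IsBiconvexAt θ S ↔ SectionsConvex θ S ∧ SectionsConvex (θ + Real.pi / 2) S := by
  rw [IsBiconvexAt, ← forall_convex_line_iff, ← forall_convex_line_iff, and_comm]
  simp only [line₁_eq, line₂_eq, coord₂_add_pi_div_two]
  refine and_congr Iff.rfl ⟨fun h β => ?_, fun h β => ?_⟩
  · have := h (-β)
    simpa only [eq_neg_iff_add_eq_zero, neg_eq_iff_add_eq_zero] using this
  · have := h (-β)
    simpa only [neg_inj] using this

/-- A closed connected set that fills its hull up to a null set has no gaps in its sections. -/
lemma sectionsConvex_of_volume_hull_diff {θ : ℝ} {S : Set Plane} (hS : IsClosed S)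
    (hconn : IsPreconnected S) (hnull : volume (hull θ S \ S) = 0) : SectionsConvex θ S := by
  intro a ha b hb p hap hbp h₁ h₂
  by_contra hp
  obtain ⟨δ₀, hδ₀, hbox₀⟩ := exists_box_disjoint hS θ hp
  obtain ⟨δ, hδ, hδa, hδb, hbox⟩ : ∃ δ > 0, δ ≤ coord₁ θ p - coord₁ θ a ∧
      δ ≤ coord₁ θ b - coord₁ θ p ∧
      ∀ x, |coord₁ θ x - coord₁ θ p| < δ → |coord₂ θ x - coord₂ θ p| < δ → x ∉ S :=
    ⟨min δ₀ (min (coord₁ θ p - coord₁ θ a) (coord₁ θ b - coord₁ θ p)),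
      lt_min hδ₀ (lt_min (by linarith) (by linarith)),
      (min_le_right _ _).trans (min_le_left _ _), (min_le_right _ _).trans (min_le_right _ _),
      fun x hx hx' => hbox₀ x (hx.trans_le (min_le_left _ _)) (hx'.trans_le (min_le_left _ _))⟩
  have key : ∀ t, IsSign t → ∃ s y, IsSign s ∧ ¬ (quadrant θ s t y ∩ S).Nonempty ∧
      |coord₁ θ y - coord₁ θ p| < δ ∧ t * (coord₂ θ y - coord₂ θ p) < δ := by
    intro t ht
    have htt : t * t = 1 := by rcases ht with rfl | rfl <;> norm_num
    let W : Set Plane := {x | |coord₁ θ x - coord₁ θ p| < δ} ∩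
      ({x | 0 < t * (coord₂ θ x - coord₂ θ p)} ∩ {x | t * (coord₂ θ x - coord₂ θ p) < δ})
    have hc₁ : Continuous fun x => |coord₁ θ x - coord₁ θ p| := by fun_prop
    have hc₂ : Continuous fun x => t * (coord₂ θ x - coord₂ θ p) := by fun_prop
    have hW : IsOpen W := (isOpen_lt hc₁ continuous_const).inter
      ((isOpen_lt continuous_const hc₂).inter (isOpen_lt hc₂ continuous_const))
    have hWne : W.Nonempty := by
      refine ⟨ofCoords θ (coord₁ θ p) (coord₂ θ p + t * (δ / 2)), ?_, ?_, ?_⟩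
      · simpa using hδ
      · change 0 < t * _
        rw [coord₂_ofCoords]; nlinarith
      · change t * _ < δ
        rw [coord₂_ofCoords]; nlinarith
    have hWS : ∀ x ∈ W, x ∉ S := fun x hx => hbox x hx.1 <| by
      have h1 : 0 < t * (coord₂ θ x - coord₂ θ p) := hx.2.1
      have h2 : t * (coord₂ θ x - coord₂ θ p) < δ := hx.2.2
      rw [abs_lt]
      rcases ht with rfl | rfl <;> constructor <;> linarith
    -- `W` is the open half of the box on side `t` of the line; it misses `S`, so if it lay in the
    -- hull, `hull θ S \ S` would have positive area.
    obtain ⟨y, hyW, hy⟩ : ∃ y ∈ W, y ∉ hull θ S := by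
      by_contra! hsub
      exact (hW.measure_pos volume hWne).ne'
        (measure_mono_null (show W ⊆ hull θ S \ S from fun x hx => ⟨hsub x hx, hWS x hx⟩) hnull)
    obtain ⟨s, t', hs, ht', hne⟩ := exists_quadrant_of_notMem_hull hy
    have hy1 : |coord₁ θ y - coord₁ θ p| < δ := hyW.1
    have hy2 : 0 < t * (coord₂ θ y - coord₂ θ p) := hyW.2.1
    -- An empty quadrant opening back across the line would contain `a` or `b`, since `δ` is at most
    -- their distances to `p`.
    obtain rfl : t' = t := by
      by_contra htt'
      have hneg : t' = -t := by
        rcases ht with rfl | rfl <;> rcases ht' with rfl | rfl <;>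
          first | exact absurd rfl htt' | norm_num
      rw [abs_lt] at hy1
      refine hne ?_
      rcases hs with rfl | rfl
      · exact ⟨b, ⟨by linarith, by rw [hneg, hbp]; linarith⟩, hb⟩
      · exact ⟨a, ⟨by linarith, by rw [hneg, hap]; linarith⟩, ha⟩
    exact ⟨s, y, hs, hne, hy1, hyW.2.2⟩
  obtain ⟨s, y, hs, hsS, hy1, hy2⟩ := key 1 (.inl rfl)
  obtain ⟨s', y', hs', hsS', hy1', hy2'⟩ := key (-1) (.inr rfl)
  -- The zero set of `F` is a bent line through `p`, leaving diagonally in directions `(s, 1)` and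
  -- `(s', -1)`. It runs inside the box up to height `δ` and then inside the two empty quadrants, so
  -- it misses `S` while separating `a` from `b`.
  let F : Plane → ℝ := fun x => coord₁ θ x - coord₁ θ p -
    (s * max (coord₂ θ x - coord₂ θ p) 0 + s' * max (-(coord₂ θ x - coord₂ θ p)) 0)
  have hF : Continuous F := by
    have := continuous_coord₁ θ
    have := continuous_coord₂ θ
    fun_prop
  have hFa : F a ≤ 0 := by simp [F, hap]; linarith
  have hFb : 0 ≤ F b := by simp [F, hbp]; linarith
  obtain ⟨x, hxS, hx⟩ := hconn.intermediate_value ha hb hF.continuousOn ⟨hFa, hFb⟩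
  simp only [F] at hx
  rw [abs_lt] at hy1 hy1'
  rcases le_total 0 (coord₂ θ x - coord₂ θ p) with hd | hd
  · rw [max_eq_left hd, max_eq_right (by linarith)] at hx
    rcases lt_or_ge (coord₂ θ x - coord₂ θ p) δ with hlt | hge
    · refine hbox x ?_ ?_ hxS <;> rw [abs_lt]
      · rcases hs with rfl | rfl <;> constructor <;> linarith
      · constructor <;> linarith
    · refine hsS ⟨x, ⟨?_, by linarith⟩, hxS⟩
      rcases hs with rfl | rfl <;> linarith
  · rw [max_eq_right hd, max_eq_left (by linarith)] at hx
    rcases lt_or_ge (-(coord₂ θ x - coord₂ θ p)) δ with hlt | hge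
    · refine hbox x ?_ ?_ hxS <;> rw [abs_lt]
      · rcases hs' with rfl | rfl <;> constructor <;> linarith
      · constructor <;> linarith
    · refine hsS' ⟨x, ⟨?_, by linarith⟩, hxS⟩
      rcases hs' with rfl | rfl <;> linarith

lemma exists_sign_ray_disjoint₁ {θ : ℝ} {S : Set Plane} (h : SectionsConvex θ S) {p : Plane}
    (hp : p ∉ S) : ∃ s, IsSign s ∧
      ∀ x ∈ S, coord₂ θ x = coord₂ θ p → ¬ 0 ≤ s * (coord₁ θ x - coord₁ θ p) := by
  by_contra! hcon
  obtain ⟨b, hb, hbp, hb'⟩ := hcon 1 (.inl rfl)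
  obtain ⟨a, ha, hap, ha'⟩ := hcon (-1) (.inr rfl)
  refine hp (h a ha b hb p hap hbp (lt_of_le_of_ne (by linarith) fun e => hp ?_)
    (lt_of_le_of_ne (by linarith) fun e => hp ?_))
  · rwa [← eq_of_coord_eq e hap]
  · rwa [← eq_of_coord_eq e.symm hbp]

lemma exists_sign_ray_disjoint₂ {θ : ℝ} {S : Set Plane} (h : SectionsConvex (θ + Real.pi / 2) S)
    {p : Plane} (hp : p ∉ S) : ∃ t, IsSign t ∧
      ∀ x ∈ S, coord₁ θ x = coord₁ θ p → ¬ 0 ≤ t * (coord₂ θ x - coord₂ θ p) := by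
  simpa only [coord₁_add_pi_div_two, coord₂_add_pi_div_two, neg_inj] using
    exists_sign_ray_disjoint₁ h hp

/-- A compact set meets each closed quadrant whose vertex is in the hull. -/
lemma exists_mem_closed_quadrant {θ s t : ℝ} (hs : IsSign s) (ht : IsSign t) {S : Set Plane}
    (hS : IsCompact S) {p : Plane} (hp : p ∈ hull θ S) :
    ∃ x ∈ S, 0 ≤ min (s * (coord₁ θ x - coord₁ θ p)) (t * (coord₂ θ x - coord₂ θ p)) := by
  have hss : s * s = 1 := by rcases hs with rfl | rfl <;> norm_num
  have htt : t * t = 1 := by rcases ht with rfl | rfl <;> norm_num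
  have key : ∀ ε > 0, ∃ x ∈ S,
      -ε < min (s * (coord₁ θ x - coord₁ θ p)) (t * (coord₂ θ x - coord₂ θ p)) := by
    intro ε hε
    obtain ⟨x, ⟨h₁, h₂⟩, hxS⟩ := mem_hull_iff.1 hp s t hs ht
      -- Moving the vertex back by `ε` puts `p` inside the open quadrant; compactness then lets `ε`
      -- go to `0`.
      (ofCoords θ (coord₁ θ p - s * ε) (coord₂ θ p - t * ε))
      ⟨by rw [coord₁_ofCoords]; nlinarith, by rw [coord₂_ofCoords]; nlinarith⟩
    rw [coord₁_ofCoords] at h₁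
    rw [coord₂_ofCoords] at h₂
    exact ⟨x, hxS, lt_min (by nlinarith) (by nlinarith)⟩
  obtain ⟨x₀, hx₀, -⟩ := key 1 one_pos
  have hcont : Continuous fun x =>
      min (s * (coord₁ θ x - coord₁ θ p)) (t * (coord₂ θ x - coord₂ θ p)) := by fun_prop
  obtain ⟨x, hx, hmax⟩ := hS.exists_isMaxOn ⟨x₀, hx₀⟩ hcont.continuousOn
  refine ⟨x, hx, ?_⟩
  by_contra! hneg
  obtain ⟨z, hz, hlt⟩ := key _ (neg_pos.2 hneg)
  rw [neg_neg] at hlt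
  exact absurd (hmax hz) (not_le.2 hlt)

/-- A compact connected biconvex set is equal to its hull. -/
lemma hull_subset_of_isBiconvexAt {θ : ℝ} {S : Set Plane} (hS : IsCompact S)
    (hconn : IsPreconnected S) (h : IsBiconvexAt θ S) : hull θ S ⊆ S := by
  intro p hp
  by_contra hpS
  obtain ⟨h₁, h₂⟩ := isBiconvexAt_iff.1 h
  obtain ⟨s, hs, hs'⟩ := exists_sign_ray_disjoint₁ h₁ hpS
  obtain ⟨t, ht, ht'⟩ := exists_sign_ray_disjoint₂ h₂ hpS
  obtain ⟨x, hx, hx'⟩ := exists_mem_closed_quadrant hs ht hS hp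
  obtain ⟨z, hz, hz'⟩ := exists_mem_closed_quadrant hs.neg ht.neg hS hp
  have hcont : Continuous fun x =>
      min (s * (coord₁ θ x - coord₁ θ p)) (t * (coord₂ θ x - coord₂ θ p)) := by fun_prop
  have hz0 : min (s * (coord₁ θ z - coord₁ θ p)) (t * (coord₂ θ z - coord₂ θ p)) ≤ 0 := by
    refine (min_le_left _ _).trans ?_
    have := hz'.trans (min_le_left _ _)
    linarith
  -- The zero set of this minimum is the boundary of the closed quadrant at `p`: two rays, each
  -- contained in a ray that misses `S`.
  obtain ⟨w, hw, hw'⟩ := hconn.intermediate_value hz hx hcont.continuousOn ⟨hz0, hx'⟩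
  have hs0 : s ≠ 0 := by rcases hs with rfl | rfl <;> norm_num
  have ht0 : t ≠ 0 := by rcases ht with rfl | rfl <;> norm_num
  rcases min_choice (s * (coord₁ θ w - coord₁ θ p)) (t * (coord₂ θ w - coord₂ θ p)) with e | e
  · have e0 : s * (coord₁ θ w - coord₁ θ p) = 0 := e ▸ hw'
    refine ht' w hw (sub_eq_zero.1 ((mul_eq_zero.1 e0).resolve_left hs0)) ?_
    exact hw'.ge.trans (min_le_right _ _)
  · have e0 : t * (coord₂ θ w - coord₂ θ p) = 0 := e ▸ hw'
    refine hs' w hw (sub_eq_zero.1 ((mul_eq_zero.1 e0).resolve_left ht0)) ?_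
    exact hw'.ge.trans (min_le_left _ _)

/-! ### Area of the hull -/

/-- Multiplying the quotient by `2 * ε` shows that the areas of the parallel sets, which contain
`E`, tend to `L * 0`. -/
lemma HasMinkowskiContent.volume_eq_zero {E : Set Plane} {L : ℝ≥0}
    (h : HasMinkowskiContent E L) : volume E = 0 := by
  have h₁ : Tendsto (fun ε : ℝ => ENNReal.ofReal (2 * ε)) (𝓝[>] 0) (𝓝 0) := by
    have : Tendsto (fun ε : ℝ => ENNReal.ofReal (2 * ε)) (𝓝 0) (𝓝 (ENNReal.ofReal (2 * 0))) :=
      (ENNReal.continuous_ofReal.comp (continuous_const.mul continuous_id)).tendsto 0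
    simpa using this.mono_left nhdsWithin_le_nhds
  have h₂ := ENNReal.Tendsto.mul h (.inr ENNReal.zero_ne_top) h₁ (.inr ENNReal.coe_ne_top)
  rw [mul_zero] at h₂
  refine le_antisymm (ge_of_tendsto h₂ ?_) zero_le
  filter_upwards [self_mem_nhdsWithin] with ε hε
  have hε : (0 : ℝ) < ε := hε
  rw [ENNReal.div_mul_cancel (by simpa using hε) ENNReal.ofReal_ne_top]
  exact measure_mono fun x hx => Set.mem_biUnion hx (Metric.mem_closedBall_self hε.le)

/-- The points all of whose open quadrants meet `A`. -/
def hullCore (θ : ℝ) (A : Set Plane) : Set Plane :=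
  {y | ∀ s t : ℝ, IsSign s → IsSign t → (quadrant θ s t y ∩ A).Nonempty}

lemma hullCore_subset_hull (θ : ℝ) (A : Set Plane) : hullCore θ A ⊆ hull θ A := fun _ hx =>
  mem_hull_iff.2 fun s t hs ht _ hy =>
    (hx s t hs ht).mono (Set.inter_subset_inter_left A (quadrant_subset hy))

lemma mem_closure_quadrant {θ s t : ℝ} (hs : IsSign s) (ht : IsSign t) (y : Plane) :
    y ∈ closure (quadrant θ s t y) := by
  have hss : s * s = 1 := by rcases hs with rfl | rfl <;> norm_num
  have htt : t * t = 1 := by rcases ht with rfl | rfl <;> norm_num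
  let f : ℝ → Plane := fun r => ofCoords θ (coord₁ θ y + s * r) (coord₂ θ y + t * r)
  have hf : Continuous f := by unfold f ofCoords; fun_prop
  have h0 : f 0 = y := by simp only [f, mul_zero, add_zero, ofCoords_coord]
  refine mem_closure_of_tendsto (f := f) (b := 𝓝[>] 0) ?_ ?_
  · have := hf.tendsto 0
    rw [h0] at this
    exact this.mono_left nhdsWithin_le_nhds
  · filter_upwards [self_mem_nhdsWithin] with r hr
    have hr : (0 : ℝ) < r := hr
    constructor
    · simp only [f, coord₁_ofCoords]; nlinarith
    · simp only [f, coord₂_ofCoords]; nlinarith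

/-- Such a point is the vertex of an empty open quadrant; that quadrant lies outside the hull and
accumulates at its vertex. -/
lemma hull_diff_hullCore_subset_frontier (θ : ℝ) (A : Set Plane) :
    hull θ A \ hullCore θ A ⊆ frontier (hull θ A) := by
  rintro y ⟨hy, hy'⟩
  rw [frontier_eq_closure_inter_closure]
  refine ⟨subset_closure hy, ?_⟩
  simp only [hullCore, Set.mem_ofPred_eq, not_forall] at hy'
  obtain ⟨s, t, hs, ht, hne⟩ := hy'
  exact closure_mono (disjoint_quadrant_hull hs ht hne) (mem_closure_quadrant hs ht y)

lemma volume_hull_le_hullCore {θ : ℝ} {A : Set Plane} (h : volume (frontier (hull θ A)) = 0) :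
    volume (hull θ A) ≤ volume (hullCore θ A) := by
  calc volume (hull θ A)
      ≤ volume (hullCore θ A ∪ frontier (hull θ A)) := measure_mono fun x hx => by
        by_cases hc : x ∈ hullCore θ A
        · exact .inl hc
        · exact .inr (hull_diff_hullCore_subset_frontier θ A ⟨hx, hc⟩)
    _ ≤ volume (hullCore θ A) + volume (frontier (hull θ A)) := measure_union_le _ _
    _ = volume (hullCore θ A) := by rw [h, add_zero]

/-- Points of the core of the limit set belong to the hulls of approximating sets, along
converging angles. -/
lemma eventually_mem_hull {ι : Type*} {l : Filter ι} {θ : ℝ} {S : Set Plane} {φ : ι → ℝ}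
    {A : ι → Set Plane} (hφ : Tendsto φ l (𝓝 θ))
    (hA : ∀ x ∈ S, ∀ U ∈ 𝓝 x, ∀ᶠ n in l, (U ∩ A n).Nonempty) {y : Plane}
    (hy : y ∈ hullCore θ S) : ∀ᶠ n in l, y ∈ hull (φ n) (A n) := by
  have key : ∀ s t : ℝ, IsSign s → IsSign t → ∀ᶠ n in l, (quadrant (φ n) s t y ∩ A n).Nonempty := by
    intro s t hs ht
    obtain ⟨x, ⟨h₁, h₂⟩, hxS⟩ := hy s t hs ht
    have hc₁ : Continuous fun q : ℝ × Plane => s * (coord₁ q.1 q.2 - coord₁ q.1 y) := by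
      unfold coord₁; fun_prop
    have hc₂ : Continuous fun q : ℝ × Plane => t * (coord₂ q.1 q.2 - coord₂ q.1 y) := by
      unfold coord₂; fun_prop
    -- Membership in the quadrant is an open condition jointly in the angle and the point.
    have hev : ∀ᶠ q : ℝ × Plane in 𝓝 (θ, x), q.2 ∈ quadrant q.1 s t y :=
      ((hc₁.tendsto (θ, x)).eventually_const_lt h₁).and
        ((hc₂.tendsto (θ, x)).eventually_const_lt h₂)
    rw [nhds_prod_eq] at hev
    obtain ⟨pa, hpa, pb, hpb, hab⟩ := eventually_prod_iff.1 hev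
    filter_upwards [hφ.eventually hpa, hA x hxS _ hpb] with n hn hn'
    obtain ⟨z, hz, hzA⟩ := hn'
    exact ⟨z, hab hn hz, hzA⟩
  filter_upwards [key 1 1 (.inl rfl) (.inl rfl), key 1 (-1) (.inl rfl) (.inr rfl),
    key (-1) 1 (.inr rfl) (.inl rfl), key (-1) (-1) (.inr rfl) (.inr rfl)] with n h₁ h₂ h₃ h₄
  refine hullCore_subset_hull _ _ ?_
  rintro s t (rfl | rfl) (rfl | rfl) <;> assumption

/-- Fatou's lemma for sets: `K` lies in the increasing union of the tail intersections, each of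
measure at most `c`. -/
lemma measure_le_of_eventually_mem {α : Type*} [MeasurableSpace α] {μ : Measure α} {K : Set α}
    {B : ℕ → Set α} {c : ℝ≥0∞} (hK : ∀ y ∈ K, ∀ᶠ n in atTop, y ∈ B n) (hB : ∀ n, μ (B n) ≤ c) :
    μ K ≤ c := by
  have hmono : Monotone fun N => ⋂ n ≥ N, B n := fun M N hMN x hx => by
    simp only [Set.mem_iInter] at hx ⊢
    exact fun n hn => hx n (hMN.trans hn)
  calc μ K ≤ μ (⋃ N, ⋂ n ≥ N, B n) := measure_mono fun y hy => by
        obtain ⟨N, hN⟩ := eventually_atTop.1 (hK y hy)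
        exact Set.mem_iUnion.2 ⟨N, by simpa using hN⟩
    _ = ⨆ N, μ (⋂ n ≥ N, B n) := hmono.measure_iUnion
    _ ≤ c := iSup_le fun N => (measure_mono (Set.biInter_subset_of_mem (le_refl N))).trans (hB N)

/-- A compact connected set is biconvex at each limit of angles along which the hulls of
approximating sets have at most the area of the set. -/
lemma isBiconvexAt_of_tendsto {θ : ℝ} {S : Set Plane} (hS : IsCompact S) (hconn : IsPreconnected S)
    (hfr : volume (frontier (hull θ S)) = 0) {φ : ℕ → ℝ} {A : ℕ → Set Plane}
    (hφ : Tendsto φ atTop (𝓝 θ))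
    (hA : ∀ x ∈ S, ∀ U ∈ 𝓝 x, ∀ᶠ n in atTop, (U ∩ A n).Nonempty)
    (hvol : ∀ n, volume (hull (φ n) (A n)) ≤ volume S) : IsBiconvexAt θ S := by
  have hle : volume (hull θ S) ≤ volume S := (volume_hull_le_hullCore hfr).trans <|
    measure_le_of_eventually_mem (fun _ hy => eventually_mem_hull hφ hA hy) hvol
  have hnull : volume (hull θ S \ S) = 0 := by
    rw [measure_sdiff (subset_hull θ S) hS.measurableSet.nullMeasurableSet
      hS.measure_lt_top.ne, tsub_eq_zero_iff_le]
    exact hle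
  refine isBiconvexAt_iff.2 ⟨sectionsConvex_of_volume_hull_diff hS.isClosed hconn hnull,
    sectionsConvex_of_volume_hull_diff hS.isClosed hconn ?_⟩
  rwa [hull_add_pi_div_two]

/-- From angle `0` to `π` both coordinates change sign, which only swaps the endpoints of a section.
-/
lemma isBiconvexAt_zero_of_pi_div_two {S : Set Plane} (h : IsBiconvexAt (Real.pi / 2) S) :
    IsBiconvexAt 0 S := by
  obtain ⟨h₁, h₂⟩ := isBiconvexAt_iff.1 h
  refine isBiconvexAt_iff.2 ⟨fun a ha b hb p hap hbp hlt hlt' => ?_, by rwa [zero_add]⟩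
  have e₁ : ∀ x, coord₁ (Real.pi / 2 + Real.pi / 2) x = -coord₁ 0 x := fun x => by
    simp [coord₁]
  have e₂ : ∀ x, coord₂ (Real.pi / 2 + Real.pi / 2) x = -coord₂ 0 x := fun x => by
    simp [coord₂]
  exact h₂ b hb a ha p (by rw [e₂, e₂, hbp]) (by rw [e₂, e₂, hap])
    (by rw [e₁, e₁]; linarith) (by rw [e₁, e₁]; linarith)

/-! ### Independent samples -/

section Sample

variable {Ω E : Type*} [MeasurableSpace Ω] {P : Measure Ω} [MeasurableSpace E]
  {μ : Measure E} {X : ℕ → Ω → E}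

/-- Independent samples almost surely visit each set of positive measure. -/
lemma ae_exists_mem_of_measure_pos [IsProbabilityMeasure P] (hlaw : ∀ i, HasLaw (X i) μ P)
    (hindep : iIndepFun X P) {U : Set E} (hU : MeasurableSet U) (hpos : 0 < μ U) :
    ∀ᵐ ω ∂P, ∃ i, X i ω ∈ U := by
  have : IsProbabilityMeasure μ := by
    rw [← (hlaw 0).map_eq]
    exact Measure.isProbabilityMeasure_map (hlaw 0).aemeasurable
  have hq : μ Uᶜ < 1 := by
    rw [prob_compl_eq_one_sub hU]
    exact ENNReal.sub_lt_self ENNReal.one_ne_top one_ne_zero hpos.ne'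
  -- By independence, the first `n` points all miss `U` with probability `μ Uᶜ ^ n`, which tends to
  -- `0`.
  have hle : ∀ n : ℕ, P {ω | ¬ ∃ i, X i ω ∈ U} ≤ μ Uᶜ ^ n := by
    intro n
    calc P {ω | ¬ ∃ i, X i ω ∈ U} ≤ P (⋂ i ∈ Finset.range n, X i ⁻¹' Uᶜ) :=
          measure_mono fun ω hω => Set.mem_iInter₂.2 fun i _ hi => hω ⟨i, hi⟩
      _ = ∏ i ∈ Finset.range n, P (X i ⁻¹' Uᶜ) :=
          hindep.measure_inter_preimage_eq_mul _ fun _ _ => hU.compl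
      _ = μ Uᶜ ^ n := by
          have : ∀ i, P (X i ⁻¹' Uᶜ) = μ Uᶜ := fun i => by
            rw [← (hlaw i).map_eq,
              Measure.map_apply_of_aemeasurable (hlaw i).aemeasurable hU.compl]
          rw [Finset.prod_congr rfl fun i _ => this i, Finset.prod_const, Finset.card_range]
  exact le_antisymm (ge_of_tendsto' (ENNReal.tendsto_pow_atTop_nhds_zero_of_lt_one hq) hle)
    zero_le

lemma ae_forall_mem_support [TopologicalSpace E] [HereditarilyLindelofSpace E]
    (hlaw : ∀ i, HasLaw (X i) μ P) :
    ∀ᵐ ω ∂P, ∀ i, X i ω ∈ μ.support := by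
  refine ae_all_iff.2 fun i => ?_
  have h : ∀ᵐ x ∂(P.map (X i)), x ∈ μ.support := by
    rw [(hlaw i).map_eq]
    exact Measure.support_mem_ae
  exact ae_of_ae_map (hlaw i).aemeasurable h

/-- A countable basis lets one null set serve all points and neighbourhoods. -/
lemma ae_forall_nhds_exists_mem [TopologicalSpace E] [SecondCountableTopology E]
    [OpensMeasurableSpace E] [IsProbabilityMeasure P] (hlaw : ∀ i, HasLaw (X i) μ P)
    (hindep : iIndepFun X P) : ∀ᵐ ω ∂P, ∀ x ∈ μ.support, ∀ U ∈ 𝓝 x, ∃ i, X i ω ∈ U := by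
  have h : ∀ᵐ ω ∂P, ∀ V ∈ TopologicalSpace.countableBasis E, 0 < μ V → ∃ i, X i ω ∈ V := by
    refine (ae_ball_iff (TopologicalSpace.countable_countableBasis E)).2 fun V hV => ?_
    by_cases hpos : 0 < μ V
    · filter_upwards [ae_exists_mem_of_measure_pos hlaw hindep
        (TopologicalSpace.isOpen_of_mem_countableBasis hV).measurableSet hpos] with ω hω _
      exact hω
    · exact .of_forall fun ω h => absurd h hpos
  filter_upwards [h] with ω hω x hx U hU
  obtain ⟨V, hV, hxV, hVU⟩ := (TopologicalSpace.isBasis_countableBasis E).mem_nhds_iff.1 hU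
  obtain ⟨i, hi⟩ := hω V hV ((Measure.mem_support_iff_forall x).1 hx V
    ((TopologicalSpace.isOpen_of_mem_countableBasis hV).mem_nhds hxV))
  exact ⟨i, hVU hi⟩

end Sample

end Biconvex

end

theorem theorem4 {Ω : Type*} [MeasurableSpace Ω] (P : Measure Ω) [IsProbabilityMeasure P]
    (S : Set Biconvex.Plane) (hS : IsCompact S) (hconn : IsPathConnected S)
    (hA : (Biconvex.biconvexityAngles S).Nonempty)
    (L₀ : ℝ≥0)
    (hL : ∀ θ ∈ Set.Ico 0 (Real.pi / 2), ∃ L : ℝ≥0,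
      Biconvex.HasMinkowskiContent (frontier (Biconvex.hull θ S)) L ∧ L ≤ L₀)
    (PX : Measure Biconvex.Plane) (hsupp : PX.support = S)
    (X : ℕ → Ω → Biconvex.Plane) (hlaw : ∀ i, HasLaw (X i) PX P) (hindep : iIndepFun X P)
    (θhat : ℕ → Ω → ℝ)
    (hθ : ∀ n, ∀ᵐ ω ∂P, θhat n ω ∈ Biconvex.argminAngles X n ω) :
    ∀ᵐ ω ∂P, ∀ θ : ℝ, MapClusterPt θ atTop (fun n => θhat n ω) →
      θ ∈ Biconvex.biconvexityAngles S ∨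
        (θ = Real.pi / 2 ∧ 0 ∈ Biconvex.biconvexityAngles S) := by
  have hsample : ∀ᵐ ω ∂P, ∀ i, X i ω ∈ S := hsupp ▸ Biconvex.ae_forall_mem_support hlaw
  have hdense : ∀ᵐ ω ∂P, ∀ x ∈ S, ∀ U ∈ 𝓝 x, ∃ i, X i ω ∈ U :=
    hsupp ▸ Biconvex.ae_forall_nhds_exists_mem hlaw hindep
  obtain ⟨θ₀, hθ₀, hbi⟩ := hA
  have hpre : IsPreconnected S := hconn.isConnected.isPreconnected
  filter_upwards [hsample, hdense, ae_all_iff.2 hθ] with ω hXS hXdense hmin θ hcl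
  obtain ⟨ψ, hψ, hlim⟩ := hcl.tendsto_subseq
  have hmem : θ ∈ Set.Icc 0 (Real.pi / 2) :=
    isClosed_Icc.mem_of_tendsto hlim (.of_forall fun n => (hmin (ψ n)).1)
  have hfr : volume (frontier (Biconvex.hull θ S)) = 0 := by
    rcases hmem.2.eq_or_lt with heq | hlt
    · have e := Biconvex.hull_add_pi_div_two 0 S
      rw [zero_add] at e
      obtain ⟨L, hc, -⟩ := hL 0 ⟨le_rfl, by positivity⟩
      rw [heq, e]
      exact hc.volume_eq_zero
    · obtain ⟨L, hc, -⟩ := hL θ ⟨hmem.1, hlt⟩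
      exact hc.volume_eq_zero
  have hbiθ : Biconvex.IsBiconvexAt θ S := by
    refine Biconvex.isBiconvexAt_of_tendsto hS hpre hfr hlim
      (A := fun n => Biconvex.sample X (ψ n) ω) (fun x hx U hU => ?_) (fun n => ?_)
    · obtain ⟨i, hi⟩ := hXdense x hx U hU
      filter_upwards [eventually_gt_atTop i] with n hn
      exact ⟨X i ω, hi, i, hn.trans_le hψ.le_apply, rfl⟩
    -- The minimizer is compared with `θ₀`, where the sample hull is contained in `S`.
    · refine ((hmin (ψ n)).2 θ₀ ⟨hθ₀.1, hθ₀.2.le⟩).trans (measure_mono ?_)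
      refine (Biconvex.hull_mono θ₀ ?_).trans (Biconvex.hull_subset_of_isBiconvexAt hS hpre hbi)
      rintro _ ⟨i, -, rfl⟩
      exact hXS i
  rcases hmem.2.eq_or_lt with heq | hlt
  · subst heq
    exact .inr ⟨rfl, ⟨le_rfl, by positivity⟩, Biconvex.isBiconvexAt_zero_of_pi_div_two hbiθ⟩
  · exact .inl ⟨⟨hmem.1, hlt⟩, hbiθ⟩
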